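/- Let $n\ge 2$. A frame of $\mathbb{R}^n$ is an orthonormal basis $F=\{u_1,\dots,u_n\}$. For a convex body $K\subset\mathbb{R}^n$ put $$\Lambda(K;F)=\frac{\operatorname{vol}_n(K)^{n-1}}{\prod_{i=1}^n \operatorname{vol}_{n-1}(K|u_i^\perp)},\qquad \Lambda(K)=\max_{F}\Lambda(K;F),$$ where $K|u^\perp$ is the orthogonal projection of $K$ onto the hyperplane $u^\perp$ and $F$ ranges over all frames. Let $C_n=\operatorname{conv}\{\pm e_1,\dots,\pm e_n\}$ be the regular crosspolytope. Then the maximum defining $\Lambda(C_n)$ is attained, and $$\Lambda(C_n)\ \ge\ \begin{cases}\dfrac{(n-1)!\,2^{n/2}}{n^{n-1}} & n \text{ even},\\[2mm] \dfrac{(n-1)!\,2^{(n-1)/2}}{n^{n-1}} & n\text{ odd}.\end{cases}$$ More precisely, let $F$ be the frame consisting of the vectors $u_{2i-1}=\frac1{\sqrt2}(e_{2i-1}+e_{2i})$ and $u_{2i}=\frac1{\sqrt2}(e_{2i-1}-e_{2i})$ for $1\le i\le\lfloor n/2\rfloor$, together with $u_n=e_n$ if $n$ is odd. Then all $u_j$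 with $j\le 2\lfloor n/2\rfloor$ are directions of edges of $C_n$, and $\Lambda(C_n;F)$ equals the right-hand side above. -/

import Mathlib

open MeasureTheory

/-- A frame of `ℝⁿ`: an orthonormal basis `u₁, …, uₙ`, indexed by `Fin n`. -/
abbrev Frame (n : ℕ) := OrthonormalBasis (Fin n) ℝ (EuclideanSpace ℝ (Fin n))

/-- `vol_{n-1}(K | u^⊥)`: the `(n-1)`-dimensional volume of the orthogonal projection of `K` onto
the hyperplane through the origin orthogonal to `u`. Here `μHE[n-1]` is the Hausdorff measure
normalized so that it agrees with Lebesgue measure on `(n-1)`-dimensional Euclidean spaces. -/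
noncomputable def projVol {n : ℕ} (K : Set (EuclideanSpace ℝ (Fin n)))
    (u : EuclideanSpace ℝ (Fin n)) : ℝ :=
  (μHE[n - 1] : Measure (EuclideanSpace ℝ (Fin n))).real
    ((Submodule.span ℝ {u})ᗮ.starProjection '' K)

/-- The projection average `Ψ(K; F) = ∏ i, vol_{n-1}(K | uᵢ^⊥)`. -/
noncomputable def projAverage {n : ℕ} (K : Set (EuclideanSpace ℝ (Fin n))) (F : Frame n) : ℝ :=
  ∏ i, projVol K (F i)

/-- The LW-ratio `Λ(K; F) = vol_n(K)^{n-1} / Ψ(K; F)`. -/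
noncomputable def lwRatio {n : ℕ} (K : Set (EuclideanSpace ℝ (Fin n))) (F : Frame n) : ℝ :=
  (volume : Measure (EuclideanSpace ℝ (Fin n))).real K ^ (n - 1) / projAverage K F

/-- The LW-constant `Λ(K)`: the supremum of `Λ(K; F)` over all frames `F`. (That it is a maximum
is asserted separately.) -/
noncomputable def lwConstant {n : ℕ} (K : Set (EuclideanSpace ℝ (Fin n))) : ℝ :=
  sSup (Set.range (lwRatio K))

/-- The regular crosspolytope `C_n = conv {± e₁, …, ± eₙ}`. -/
def crosspolytope (n : ℕ) : Set (EuclideanSpace ℝ (Fin n)) :=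
  convexHull ℝ {x | ∃ i : Fin n,
    x = EuclideanSpace.single i (1 : ℝ) ∨ x = -EuclideanSpace.single i (1 : ℝ)}

/-- `u` is a (nonzero) direction vector of an edge of `K`, that is, of a nondegenerate segment
`[a, b]` that is an exposed face of `K`. -/
def IsEdgeDirection {n : ℕ} (K : Set (EuclideanSpace ℝ (Fin n)))
    (u : EuclideanSpace ℝ (Fin n)) : Prop :=
  u ≠ 0 ∧ ∃ a b : EuclideanSpace ℝ (Fin n), a ≠ b ∧ IsExposed ℝ K (segment ℝ a b) ∧
    ∃ c : ℝ, u = c • (b - a)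

/-- The coordinates are grouped into consecutive pairs `(i, i + 1)`, `i` even (counting from `0`),
and `F` consists of the vectors `(eᵢ + eᵢ₊₁)/√2` and `(eᵢ - eᵢ₊₁)/√2` for each pair, in this order,
together with the last coordinate vector if that one is left over (`n` odd). -/
def IsPairedFrame {n : ℕ} (F : Frame n) : Prop :=
  (∀ i j : Fin n, Even (i : ℕ) → (j : ℕ) = i + 1 →
    F i = (1 / √2 : ℝ) • (EuclideanSpace.single i (1 : ℝ) + EuclideanSpace.single j (1 : ℝ)) ∧
    F j = (1 / √2 : ℝ) • (EuclideanSpace.single i (1 : ℝ) - EuclideanSpace.single j (1 : ℝ))) ∧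
  (∀ i : Fin n, Even (i : ℕ) → (i : ℕ) + 1 = n → F i = EuclideanSpace.single i (1 : ℝ))

/-! The crosspolytope is the unit ball of the ℓ¹ norm, so its volume is `2 ^ n / n!`. For a frame
`F`, the projection onto the hyperplane orthogonal to `F j` is read off in the coordinates along the
other frame vectors, and its volume becomes a Lebesgue volume (`projVol_eq_volume_coordShadow`).

That volume depends on the direction `F j` alone, so the rest of the frame may be chosen freely. For
the direction `(e_j ± e_q)/√2`, keep the other coordinate vectors and add only the partner `(e_j ∓
e_q)/√2`. The shadow is then a crosspolytope whose semi-axis along the partner is `1/√2` and whose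
other semi-axes are `1`. Each paired direction thus contributes a factor `√2` to the ratio
(`projVol_crosspolytope_of_swap`).

The maximum is attained because orthonormal families form a compact set on which the product of
shadow volumes is positive and lower semicontinuous: shadows for nearby frames lie in slight dilates
of each other (`coordShadow_crosspolytope_subset`). -/

theorem sum_abs_single {ι : Type*} [Fintype ι] [DecidableEq ι] (i : ι) (c : ℝ) :
    ∑ k, |(EuclideanSpace.single i c : EuclideanSpace ℝ ι) k| = |c| := by
  rw [Finset.sum_eq_single i] <;> simp +contextual

theorem convex_sum_abs_le {ι : Type*} [Fintype ι] (r : ℝ) :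
    Convex ℝ {x : EuclideanSpace ℝ ι | ∑ i, |x i| ≤ r} := by
  intro x hx y hy a b ha hb hab
  simp only [Set.mem_ofPred_eq, PiLp.add_apply, PiLp.smul_apply, smul_eq_mul] at *
  calc ∑ i, |a * x i + b * y i| ≤ ∑ i, (a * |x i| + b * |y i|) := by
        refine Finset.sum_le_sum fun i _ => (abs_add_le _ _).trans ?_
        rw [abs_mul, abs_mul, abs_of_nonneg ha, abs_of_nonneg hb]
    _ = a * ∑ i, |x i| + b * ∑ i, |y i| := by
        rw [Finset.sum_add_distrib, Finset.mul_sum, Finset.mul_sum]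
    _ ≤ a * r + b * r := by gcongr
    _ = r := by rw [← add_mul, hab, one_mul]

theorem mem_crosspolytope {n : ℕ} (hn : 0 < n) (x : EuclideanSpace ℝ (Fin n)) :
    x ∈ crosspolytope n ↔ ∑ i, |x i| ≤ 1 := by
  constructor
  · intro hx
    refine convexHull_min ?_ (convex_sum_abs_le 1) hx
    rintro _ ⟨i, rfl | rfl⟩
    · exact (sum_abs_single i 1).le.trans (by simp)
    · simp only [Set.mem_ofPred_eq, PiLp.neg_apply, abs_neg]
      exact (sum_abs_single i 1).le.trans (by simp)
  · intro hx
    have hconv : Convex ℝ (crosspolytope n) := convex_convexHull _ _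
    have hpos : ∀ i, EuclideanSpace.single i (1 : ℝ) ∈ crosspolytope n := fun i =>
      subset_convexHull _ _ ⟨i, Or.inl rfl⟩
    have hneg : ∀ i, -EuclideanSpace.single i (1 : ℝ) ∈ crosspolytope n := fun i =>
      subset_convexHull _ _ ⟨i, Or.inr rfl⟩
    have hzero : (0 : EuclideanSpace ℝ (Fin n)) ∈ crosspolytope n := by
      have h := hconv (hpos ⟨0, hn⟩) (hneg ⟨0, hn⟩) (by norm_num : (0 : ℝ) ≤ 1 / 2)
        (by norm_num : (0 : ℝ) ≤ 1 / 2) (by norm_num)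
      simpa using h
    have hrep : x = ∑ i, EuclideanSpace.single i (x i) := by
      ext k
      simp [Finset.sum_apply, Pi.single_apply]
    rcases (Finset.sum_nonneg fun i _ => abs_nonneg (x i) : 0 ≤ ∑ i, |x i|).eq_or_lt with h0 | h0
    · have : x = 0 := by
        ext i
        simpa using (Finset.sum_eq_zero_iff_of_nonneg fun i _ => abs_nonneg (x i)).1 h0.symm i
          (Finset.mem_univ i)
      rwa [this]
    · set S := ∑ i, |x i|
      have hmem : ∑ i, (|x i| / S) • (if 0 ≤ x i then EuclideanSpace.single i (1 : ℝ)
          else -EuclideanSpace.single i (1 : ℝ)) ∈ crosspolytope n := by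
        refine hconv.sum_mem (fun i _ => by positivity) ?_ fun i _ => ?_
        · rw [← Finset.sum_div, div_self h0.ne']
        · split_ifs
          exacts [hpos i, hneg i]
      have := hconv.smul_mem_of_zero_mem hzero hmem ⟨h0.le, hx⟩
      convert this using 1
      rw [Finset.smul_sum]
      conv_lhs => rw [hrep]
      refine Finset.sum_congr rfl fun i _ => ?_
      rw [smul_smul, mul_div_cancel₀ _ h0.ne']
      ext k
      split_ifs with h
      · simp [abs_of_nonneg h]
      · simp [abs_of_neg (not_le.1 h)]

/-! ### Shadows in frame coordinates -/

/-- The coordinates, with respect to the vectors of `F` other than `F j`, of the points of `K`. -/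
def coordShadow {n : ℕ} (K : Set (EuclideanSpace ℝ (Fin n))) (F : Frame n) (j : Fin n) :
    Set ({k : Fin n // k ≠ j} → ℝ) :=
  (fun x (k : {k : Fin n // k ≠ j}) => inner ℝ (F k) x) '' K

theorem starProjection_frame {n : ℕ} (F : Frame n) (j : Fin n) (x : EuclideanSpace ℝ (Fin n)) :
    (Submodule.span ℝ {F j})ᗮ.starProjection x =
      ∑ k : {k : Fin n // k ≠ j}, (inner ℝ (F k) x : ℝ) • F k := by
  have h := F.sum_repr' x
  rw [Fintype.sum_eq_add_sum_subtype_ne _ j] at h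
  rw [Submodule.starProjection_orthogonal_val,
    Submodule.starProjection_unit_singleton ℝ (F.norm_eq_one j)]
  exact sub_eq_of_eq_add' h.symm

/-- The frame vectors other than `F j` define a linear isometry onto the hyperplane, and the
normalized Hausdorff measure is preserved by isometries. -/
theorem projVol_eq_volume_coordShadow {n : ℕ} (K : Set (EuclideanSpace ℝ (Fin n))) (F : Frame n)
    (j : Fin n) : projVol K (F j) = (volume : Measure _).real (coordShadow K F j) := by
  classical
  let b := EuclideanSpace.basisFun {k : Fin n // k ≠ j} ℝ
  have horth : Orthonormal ℝ fun k : {k : Fin n // k ≠ j} => F k :=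
    F.orthonormal.comp _ Subtype.val_injective
  let L : EuclideanSpace ℝ {k : Fin n // k ≠ j} →ₗᵢ[ℝ] EuclideanSpace ℝ (Fin n) :=
    (b.toBasis.constr ℝ fun k => F k).isometryOfOrthonormal (v := b.toBasis)
      (by simp) (by
        convert horth using 1
        ext1 k
        simp)
  have hL : ∀ y, L y = ∑ k, y k • F k := by
    intro y
    change b.toBasis.constr ℝ (fun k => F k) y = _
    simp [Module.Basis.constr_apply_fintype, b]
  have himg : (Submodule.span ℝ {F j})ᗮ.starProjection '' K =
      L '' (WithLp.ofLp ⁻¹' coordShadow K F j) := by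
    ext z
    constructor
    · rintro ⟨x, hx, rfl⟩
      refine ⟨WithLp.toLp 2 fun k => inner ℝ (F k) x, ⟨x, hx, rfl⟩, ?_⟩
      rw [hL]
      exact (starProjection_frame F j x).symm
    · rintro ⟨y, ⟨x, hx, hxy⟩, rfl⟩
      refine ⟨x, hx, ?_⟩
      rw [hL, starProjection_frame]
      exact Finset.sum_congr rfl fun k _ => by rw [← hxy]
  have hrank : n - 1 = Module.finrank ℝ (EuclideanSpace ℝ {k : Fin n // k ≠ j}) := by
    simp [Fintype.card_subtype_compl]
  rw [projVol, himg, measureReal_def, L.isometry.euclideanHausdorffMeasure_image, hrank,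
    InnerProductSpace.euclideanHausdorffMeasure_eq_volume, measureReal_def]
  congr 1
  exact (EuclideanSpace.volume_preserving_symm_measurableEquiv_toLp _).measure_preimage_equiv _

/-! ### Volumes of weighted ℓ¹ balls -/

theorem volume_real_sum_abs_le_one {ι : Type*} [Fintype ι] [Nonempty ι] :
    (volume : Measure (ι → ℝ)).real {y | ∑ k, |y k| ≤ 1} =
      2 ^ Fintype.card ι / (Fintype.card ι).factorial := by
  have h := volume_sum_rpow_le ι (p := 1) le_rfl 1
  simp only [Real.rpow_one, div_one] at h
  rw [measureReal_def, h]
  have h2 : Real.Gamma (1 + 1) = 1 := by norm_num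
  simp only [h2, Real.Gamma_nat_eq_factorial]
  rw [ENNReal.toReal_mul, ENNReal.toReal_ofReal (by positivity)]
  simp

theorem volume_real_sum_mul_abs_le_one {ι : Type*} [Fintype ι] [Nonempty ι] (a : ι → ℝ)
    (ha : ∀ k, 0 < a k) :
    (volume : Measure (ι → ℝ)).real {y | ∑ k, a k * |y k| ≤ 1} =
      2 ^ Fintype.card ι / (Fintype.card ι).factorial / ∏ k, a k := by
  classical
  have hdet : LinearMap.det (Matrix.toLin' (Matrix.diagonal a)) = ∏ k, a k := by
    rw [LinearMap.det_toLin', Matrix.det_diagonal]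
  have hprod : 0 < ∏ k, a k := Finset.prod_pos fun k _ => ha k
  have h := Measure.addHaar_preimage_linearMap (volume : Measure (ι → ℝ))
    (f := Matrix.toLin' (Matrix.diagonal a)) (by rw [hdet]; exact hprod.ne') {y | ∑ k, |y k| ≤ 1}
  have hset : Matrix.toLin' (Matrix.diagonal a) ⁻¹' {y | ∑ k, |y k| ≤ 1} =
      {y | ∑ k, a k * |y k| ≤ 1} := by
    ext y
    simp [Matrix.mulVec_diagonal, abs_mul, abs_of_pos (ha _)]
  rw [hset, hdet] at h
  rw [measureReal_def, h, ENNReal.toReal_mul, ← measureReal_def, volume_real_sum_abs_le_one,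
    ENNReal.toReal_ofReal (by positivity), abs_of_pos (inv_pos.2 hprod)]
  field_simp

theorem volume_real_crosspolytope {n : ℕ} (hn : 0 < n) :
    (volume : Measure (EuclideanSpace ℝ (Fin n))).real (crosspolytope n) =
      2 ^ n / n.factorial := by
  have : Nonempty (Fin n) := ⟨⟨0, hn⟩⟩
  have hset : crosspolytope n = WithLp.ofLp ⁻¹' {y : Fin n → ℝ | ∑ k, |y k| ≤ 1} := by
    ext x
    exact mem_crosspolytope hn x
  have h : volume (WithLp.ofLp ⁻¹' {y : Fin n → ℝ | ∑ k, |y k| ≤ 1}) =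
      volume {y : Fin n → ℝ | ∑ k, |y k| ≤ 1} :=
    (EuclideanSpace.volume_preserving_symm_measurableEquiv_toLp _).measure_preimage_equiv _
  rw [hset, measureReal_def, h, ← measureReal_def, volume_real_sum_abs_le_one, Fintype.card_fin]

/-! ### Finiteness and positivity of shadow volumes -/

theorem norm_le_sum_abs {n : ℕ} (x : EuclideanSpace ℝ (Fin n)) : ‖x‖ ≤ ∑ i, |x i| := by
  have h : x = ∑ i, EuclideanSpace.single i (x i) := by
    ext k
    simp [Finset.sum_apply, Pi.single_apply]
  calc ‖x‖ = ‖∑ i, EuclideanSpace.single i (x i)‖ := by rw [← h]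
    _ ≤ ∑ i, ‖EuclideanSpace.single i (x i)‖ := norm_sum_le _ _
    _ = ∑ i, |x i| := by simp

theorem sum_abs_le_mul_norm {n : ℕ} (x : EuclideanSpace ℝ (Fin n)) : ∑ i, |x i| ≤ n * ‖x‖ := by
  calc ∑ i, |x i| ≤ ∑ _i : Fin n, ‖x‖ := Finset.sum_le_sum fun i _ => PiLp.norm_apply_le x i
    _ = n * ‖x‖ := by simp

theorem sum_abs_sum_smul_le {n : ℕ} {ι : Type*} (s : Finset ι) (c : ι → ℝ)
    (v : ι → EuclideanSpace ℝ (Fin n)) :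
    ∑ i, |(∑ k ∈ s, c k • v k) i| ≤ ∑ k ∈ s, |c k| * ∑ i, |v k i| := by
  calc ∑ i, |(∑ k ∈ s, c k • v k) i| ≤ ∑ i, ∑ k ∈ s, |c k| * |v k i| := by
        refine Finset.sum_le_sum fun i _ => ?_
        rw [WithLp.ofLp_sum, Finset.sum_apply]
        refine (Finset.abs_sum_le_sum_abs _ _).trans (Finset.sum_le_sum fun k _ => ?_)
        simp [abs_mul]
    _ = ∑ k ∈ s, |c k| * ∑ i, |v k i| := by
        rw [Finset.sum_comm]
        simp_rw [Finset.mul_sum]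

theorem sum_mem_coordShadow {n : ℕ} {K : Set (EuclideanSpace ℝ (Fin n))} (F : Frame n) (j : Fin n)
    (y : {k : Fin n // k ≠ j} → ℝ) (h : ∑ k, y k • F k ∈ K) : y ∈ coordShadow K F j := by
  refine ⟨_, h, ?_⟩
  ext k
  have horth : Orthonormal ℝ fun k : {k : Fin n // k ≠ j} => F k :=
    F.orthonormal.comp _ Subtype.val_injective
  exact horth.inner_right_fintype y k

theorem abs_inner_frame_le {n : ℕ} (F : Frame n) (k : Fin n) (x : EuclideanSpace ℝ (Fin n)) :
    |inner ℝ (F k) x| ≤ ‖x‖ := by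
  simpa [F.norm_eq_one] using abs_real_inner_le_norm (F k) x

theorem volume_coordShadow_crosspolytope_lt_top {n : ℕ} (hn : 0 < n) (F : Frame n) (j : Fin n) :
    volume (coordShadow (crosspolytope n) F j) < ⊤ := by
  refine (measure_mono ?_).trans_lt (Metric.isBounded_Icc (fun _ : {k : Fin n // k ≠ j} => (-1 : ℝ))
    (fun _ => 1)).measure_lt_top
  rintro _ ⟨x, hx, rfl⟩
  have hk : ∀ k, |inner ℝ (F k) x| ≤ 1 := fun k =>
    (abs_inner_frame_le F k x).trans ((norm_le_sum_abs x).trans ((mem_crosspolytope hn x).1 hx))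
  exact ⟨fun k => (abs_le.1 (hk k)).1, fun k => (abs_le.1 (hk k)).2⟩

theorem nonempty_ne {n : ℕ} (hn : 2 ≤ n) (j : Fin n) : Nonempty {k : Fin n // k ≠ j} := by
  have : Nontrivial (Fin n) := Fin.nontrivial_iff_two_le.2 hn
  obtain ⟨k, hk⟩ := exists_ne j
  exact ⟨⟨k, hk⟩⟩

theorem projVol_crosspolytope_pos {n : ℕ} (hn : 2 ≤ n) (F : Frame n) (j : Fin n) :
    0 < projVol (crosspolytope n) (F j) := by
  have hn0 : (0 : ℝ) < n := by positivity
  have := nonempty_ne hn j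
  have hball := volume_real_sum_mul_abs_le_one (fun _ : {k : Fin n // k ≠ j} => (n : ℝ))
    fun _ => hn0
  rw [projVol_eq_volume_coordShadow]
  -- Unit vectors have ℓ¹ norm at most `n`, so the shadow contains the ℓ¹ ball of radius `1/n`.
  refine lt_of_lt_of_le ?_ (measureReal_mono (s₁ := {y | ∑ k, (n : ℝ) * |y k| ≤ 1}) ?_
    (volume_coordShadow_crosspolytope_lt_top (by omega) F j).ne)
  · rw [hball]
    positivity
  · intro y hy
    refine sum_mem_coordShadow F j y ((mem_crosspolytope (by omega) _).2 ?_)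
    refine (sum_abs_sum_smul_le _ _ _).trans (le_trans (Finset.sum_le_sum fun k _ => ?_) hy)
    rw [mul_comm]
    gcongr
    simpa [F.norm_eq_one] using sum_abs_le_mul_norm (F k)

/-! ### Comparison of shadows for two frames -/

/-- `1` plus the total `ℓ¹` distance of two families of vectors. -/
def frameDistortion {n : ℕ} (v w : Fin n → EuclideanSpace ℝ (Fin n)) : ℝ :=
  1 + ∑ k, ∑ i, |(v k - w k) i|

theorem frameDistortion_pos {n : ℕ} (v w : Fin n → EuclideanSpace ℝ (Fin n)) :
    0 < frameDistortion v w := by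
  unfold frameDistortion
  positivity

open scoped Pointwise in
-- Giving the `G`-coordinates of `x` to the vectors of `F` moves `x` by `∑ ⟨G k, x⟩ (F k - G k)`.
-- Since `|⟨G k, x⟩| ≤ 1`, the ℓ¹ norm grows to at most `frameDistortion F G`.
theorem coordShadow_crosspolytope_subset {n : ℕ} (hn : 0 < n) (F G : Frame n) (j : Fin n) :
    coordShadow (crosspolytope n) G j ⊆
      frameDistortion F G • coordShadow (crosspolytope n) F j := by
  rintro _ ⟨x, hx, rfl⟩
  have hc := frameDistortion_pos F G
  rw [mem_crosspolytope hn] at hx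
  rw [Set.mem_smul_set_iff_inv_smul_mem₀ hc.ne']
  refine ⟨(frameDistortion F G)⁻¹ • ∑ k, (inner ℝ (G k) x : ℝ) • F k, ?_, ?_⟩
  · have hdecomp : ∑ k, (inner ℝ (G k) x : ℝ) • F k =
        x + ∑ k, (inner ℝ (G k) x : ℝ) • (F k - G k) := by
      simp_rw [smul_sub, Finset.sum_sub_distrib, G.sum_repr' x, add_sub_cancel]
    rw [mem_crosspolytope hn]
    have hsum : ∑ i, |(∑ k, (inner ℝ (G k) x : ℝ) • F k) i| ≤ frameDistortion F G := by
      rw [hdecomp]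
      calc ∑ i, |(x + ∑ k, (inner ℝ (G k) x : ℝ) • (F k - G k)) i|
          ≤ ∑ i, (|x i| + |(∑ k, (inner ℝ (G k) x : ℝ) • (F k - G k)) i|) :=
            Finset.sum_le_sum fun i _ => abs_add_le _ _
        _ ≤ 1 + ∑ k, |inner ℝ (G k) x| * ∑ i, |(F k - G k) i| := by
            rw [Finset.sum_add_distrib]
            exact add_le_add hx (sum_abs_sum_smul_le _ _ _)
        _ ≤ frameDistortion F G := by
            unfold frameDistortion
            gcongr with k
            refine mul_le_of_le_one_left (by positivity) ?_
            exact (abs_inner_frame_le G k x).trans ((norm_le_sum_abs x).trans hx)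
    calc _ = (frameDistortion F G)⁻¹ * ∑ i, |(∑ k, (inner ℝ (G k) x : ℝ) • F k) i| := by
          simp only [PiLp.smul_apply, smul_eq_mul, abs_mul, abs_inv, abs_of_pos hc, Finset.mul_sum]
      _ ≤ (frameDistortion F G)⁻¹ * frameDistortion F G := by gcongr
      _ = 1 := inv_mul_cancel₀ hc.ne'
  · ext k
    simp only [inner_smul_right, Pi.smul_apply, smul_eq_mul]
    rw [F.orthonormal.inner_right_fintype]

open scoped Pointwise in
theorem projVol_crosspolytope_le {n : ℕ} (hn : 0 < n) (F G : Frame n) (j : Fin n) :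
    projVol (crosspolytope n) (G j) ≤
      frameDistortion F G ^ (n - 1) * projVol (crosspolytope n) (F j) := by
  have hcard : Fintype.card {k : Fin n // k ≠ j} = n - 1 := by simp [Fintype.card_subtype_compl]
  have hvol : volume (frameDistortion F G • coordShadow (crosspolytope n) F j) =
      ENNReal.ofReal (frameDistortion F G ^ (n - 1)) *
        volume (coordShadow (crosspolytope n) F j) := by
    rw [Measure.addHaar_smul_of_nonneg _ (frameDistortion_pos F G).le, Module.finrank_pi, hcard]
  rw [projVol_eq_volume_coordShadow, projVol_eq_volume_coordShadow]
  refine (measureReal_mono (coordShadow_crosspolytope_subset hn F G j) ?_).trans_eq ?_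
  · rw [hvol]
    exact ENNReal.mul_ne_top ENNReal.ofReal_ne_top
      (volume_coordShadow_crosspolytope_lt_top hn F j).ne
  · rw [measureReal_def, hvol, ENNReal.toReal_mul, ENNReal.toReal_ofReal
      (pow_nonneg (frameDistortion_pos F G).le _), measureReal_def]

theorem projAverage_crosspolytope_pos {n : ℕ} (hn : 2 ≤ n) (F : Frame n) :
    0 < projAverage (crosspolytope n) F :=
  Finset.prod_pos fun j _ => projVol_crosspolytope_pos hn F j

theorem projAverage_crosspolytope_le {n : ℕ} (hn : 0 < n) (F G : Frame n) :
    projAverage (crosspolytope n) G ≤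
      (frameDistortion F G ^ (n - 1)) ^ n * projAverage (crosspolytope n) F := by
  calc projAverage (crosspolytope n) G
      ≤ ∏ j, frameDistortion F G ^ (n - 1) * projVol (crosspolytope n) (F j) :=
        Finset.prod_le_prod (fun j _ => measureReal_nonneg)
          fun j _ => projVol_crosspolytope_le hn F G j
    _ = _ := by
        rw [Finset.prod_mul_distrib, Finset.prod_const, Finset.card_univ, Fintype.card_fin]
        rfl

/-! ### Existence of an optimal frame -/

theorem isCompact_setOf_orthonormal (n : ℕ) :
    IsCompact {v : Fin n → EuclideanSpace ℝ (Fin n) | Orthonormal ℝ v} := by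
  refine Metric.isCompact_of_isClosed_isBounded ?_ ?_
  · simp only [orthonormal_iff_ite, Set.ofPred_forall]
    refine isClosed_iInter fun i => isClosed_iInter fun j => isClosed_eq ?_ continuous_const
    fun_prop
  · refine (Metric.isBounded_closedBall (x := 0) (r := 1)).subset fun v hv => ?_
    rw [mem_closedBall_zero_iff, pi_norm_le_iff_of_nonneg zero_le_one]
    exact fun i => (hv.1 i).le

theorem exists_frame_eq {n : ℕ} {v : Fin n → EuclideanSpace ℝ (Fin n)} (hv : Orthonormal ℝ v) :
    ∃ F : Frame n, ⇑F = v := by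
  refine ⟨OrthonormalBasis.mk hv ?_, OrthonormalBasis.coe_mk _ _⟩
  rw [hv.linearIndependent.span_eq_top_of_card_eq_finrank' (by simp)]

theorem exists_projAverage_crosspolytope_min {n : ℕ} (hn : 2 ≤ n) :
    ∃ F : Frame n, ∀ G : Frame n,
      projAverage (crosspolytope n) F ≤ projAverage (crosspolytope n) G := by
  let g : (Fin n → EuclideanSpace ℝ (Fin n)) → ℝ := fun v => ∏ j, projVol (crosspolytope n) (v j)
  have hlsc : LowerSemicontinuousOn g {v | Orthonormal ℝ v} := by
    intro w hw t ht
    obtain ⟨G, rfl⟩ := exists_frame_eq hw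
    have hcont : Continuous fun v : Fin n → EuclideanSpace ℝ (Fin n) =>
        (frameDistortion v G ^ (n - 1)) ^ n := by
      unfold frameDistortion
      fun_prop
    -- The comparison bounds `g v` below by this quotient, which tends to `g G` because the
    -- distortion tends to `1`.
    have hdiv : Filter.Tendsto (fun v : Fin n → EuclideanSpace ℝ (Fin n) =>
        g G / (frameDistortion v G ^ (n - 1)) ^ n) (nhds G) (nhds (g G)) := by
      have h := (continuous_const (y := g G)).continuousAt.div (hcont.continuousAt (x := ⇑G))
        (pow_pos (pow_pos (frameDistortion_pos _ _) _) _).ne'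
      have h1 : frameDistortion (⇑G) G = 1 := by simp [frameDistortion]
      rw [ContinuousAt] at h
      simp only [Pi.div_apply, h1, one_pow, div_one] at h
      exact h
    filter_upwards [nhdsWithin_le_nhds (hdiv.eventually_const_lt ht), self_mem_nhdsWithin]
      with v hv hv'
    obtain ⟨F, rfl⟩ := exists_frame_eq hv'
    refine hv.trans_le ?_
    rw [div_le_iff₀' (pow_pos (pow_pos (frameDistortion_pos _ _) _) _)]
    exact projAverage_crosspolytope_le (by omega) F G
  obtain ⟨v, hv, hmin⟩ := hlsc.exists_isMinOn
    (Set.nonempty_of_mem (x := ⇑(EuclideanSpace.basisFun (Fin n) ℝ))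
      (EuclideanSpace.basisFun (Fin n) ℝ).orthonormal) (isCompact_setOf_orthonormal n)
  obtain ⟨F, rfl⟩ := exists_frame_eq hv
  exact ⟨F, fun G => hmin G.orthonormal⟩

theorem isGreatest_lwConstant_crosspolytope {n : ℕ} (hn : 2 ≤ n) :
    IsGreatest (Set.range (lwRatio (crosspolytope n))) (lwConstant (crosspolytope n)) := by
  obtain ⟨F, hF⟩ := exists_projAverage_crosspolytope_min hn
  have hgreatest : IsGreatest (Set.range (lwRatio (crosspolytope n)))
      (lwRatio (crosspolytope n) F) := by
    refine ⟨⟨F, rfl⟩, ?_⟩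
    rintro _ ⟨G, rfl⟩
    exact div_le_div_of_nonneg_left (pow_nonneg measureReal_nonneg _)
      (projAverage_crosspolytope_pos hn F) (hF G)
  rw [lwConstant, hgreatest.csSup_eq]
  exact hgreatest

/-! ### Frames from involutions and their ratios -/

/-- The vectors `(eₖ + e_{σ k})/√2` and `(eₖ - e_{σ k})/√2` for the two-element orbits `k < σ k` of
an involution `σ`, and `eₖ` for its fixed points. -/
noncomputable def pairVector {n : ℕ} (σ : Fin n → Fin n) (k : Fin n) : EuclideanSpace ℝ (Fin n) :=
  if σ k = k then EuclideanSpace.single k 1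
  else if k < σ k then
    (1 / √2 : ℝ) • (EuclideanSpace.single k (1 : ℝ) + EuclideanSpace.single (σ k) (1 : ℝ))
  else (1 / √2 : ℝ) • (EuclideanSpace.single (σ k) (1 : ℝ) - EuclideanSpace.single k (1 : ℝ))

theorem inner_pairVector {n : ℕ} (σ : Fin n → Fin n) (k : Fin n) (x : EuclideanSpace ℝ (Fin n)) :
    inner ℝ (pairVector σ k) x = if σ k = k then x k else
      if k < σ k then (1 / √2) * (x k + x (σ k)) else (1 / √2) * (x (σ k) - x k) := by
  unfold pairVector
  split_ifs <;> simp [inner_add_left, inner_sub_left, inner_smul_left,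
    EuclideanSpace.inner_single_left, mul_add]

theorem one_div_sqrt_two_mul_self : (1 / √2 : ℝ) * (1 / √2) = 1 / 2 := by
  rw [div_mul_div_comm, Real.mul_self_sqrt zero_le_two, one_mul]

theorem orthonormal_pairVector {n : ℕ} {σ : Fin n → Fin n} (hσ : Function.Involutive σ) :
    Orthonormal ℝ (pairVector σ) := by
  rw [orthonormal_iff_ite]
  intro k l
  have hs := one_div_sqrt_two_mul_self
  rw [inner_pairVector]
  generalize hc : (1 / √2 : ℝ) = c at *
  have hl := hσ l
  have hk := hσ k
  have h1 : σ k = l ↔ k = σ l := ⟨fun h => by rw [← h, hk], fun h => by rw [h, hl]⟩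
  have h2 : σ k = σ l ↔ k = l := hσ.injective.eq_iff
  unfold pairVector
  rw [hc]
  by_cases hkl : k = l
  · subst hkl
    split_ifs <;> simp <;> grind
  -- Vectors from different orbits have disjoint supports; only those of one orbit need the signs to
  -- cancel.
  · by_cases hkl' : σ k = l
    · subst hkl'
      rw [hk]
      split_ifs <;> simp <;> grind
    · split_ifs <;> simp <;> grind

theorem sum_abs_pairVector_le {n : ℕ} (σ : Fin n → Fin n) (k : Fin n) :
    ∑ i, |pairVector σ k i| ≤ if σ k = k then 1 else √2 := by
  have htri : ∀ x y : EuclideanSpace ℝ (Fin n), ∑ i, |x i| ≤ 1 → ∑ i, |y i| ≤ 1 →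
      ∑ i, |((1 / √2 : ℝ) • (x + y)) i| ≤ √2 := by
    intro x y hx hy
    have h : ∑ i, |((1 / √2 : ℝ) • (x + y)) i| ≤ (1 / √2) * ∑ i, (|x i| + |y i|) := by
      rw [Finset.mul_sum]
      refine Finset.sum_le_sum fun i _ => ?_
      rw [PiLp.smul_apply, smul_eq_mul, abs_mul, abs_of_pos (by positivity)]
      gcongr
      exact abs_add_le _ _
    rw [Finset.sum_add_distrib] at h
    calc _ ≤ _ := h
      _ ≤ (1 / √2) * (1 + 1) := by gcongr
      _ = √2 := by
        field_simp
        norm_num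
  have hsingle : ∀ i : Fin n, ∑ l, |(EuclideanSpace.single i (1 : ℝ)) l| ≤ 1 := fun i =>
    (sum_abs_single i 1).le.trans (by simp)
  unfold pairVector
  split_ifs
  · exact hsingle k
  · exact htri _ _ (hsingle _) (hsingle _)
  · rw [sub_eq_add_neg]
    refine htri _ _ (hsingle _) ?_
    simpa only [PiLp.neg_apply, abs_neg] using hsingle k

theorem abs_inner_pairVector_le {n : ℕ} (σ : Fin n → Fin n) (k : Fin n)
    (x : EuclideanSpace ℝ (Fin n)) (h : σ k ≠ k) :
    √2 * |inner ℝ (pairVector σ k) x| ≤ |x k| + |x (σ k)| := by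
  have hs : √2 * (1 / √2) = 1 := by field_simp
  rw [inner_pairVector, if_neg h]
  split_ifs
  · rw [abs_mul, abs_of_pos (by positivity : 0 < 1 / √2), ← mul_assoc, hs, one_mul]
    exact abs_add_le _ _
  · rw [abs_mul, abs_of_pos (by positivity : 0 < 1 / √2), ← mul_assoc, hs, one_mul, add_comm]
    exact abs_sub _ _

/-- With only `j` and `q` paired, the shadow is exactly a weighted ℓ¹ ball. Further pairs would
spoil this, since the ℓ¹ ball of their plane is a square with sides parallel to the rotated axes. -/
theorem projVol_crosspolytope_of_swap {n : ℕ} (hn : 2 ≤ n) (j q : Fin n) (F : Frame n)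
    (hF : ⇑F = pairVector (Equiv.swap j q)) :
    projVol (crosspolytope n) (F j) =
      2 ^ (n - 1) / (n - 1).factorial / if q = j then 1 else √2 := by
  have hcard : Fintype.card {k : Fin n // k ≠ j} = n - 1 := by simp [Fintype.card_subtype_compl]
  have := nonempty_ne hn j
  have hn0 : 0 < n := by omega
  -- The weight is the ℓ¹ norm of the frame vector: `√2` for the partner of `F j`, `1` for
  -- coordinate vectors.
  let a : {k : Fin n // k ≠ j} → ℝ := fun k => if (k : Fin n) = q then √2 else 1
  have hfix : ∀ k : Fin n, k ≠ j → (Equiv.swap j q k = k ↔ k ≠ q) := by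
    intro k hk
    by_cases hkq : k = q
    · subst hkq
      simp [hk.symm]
    · simp [Equiv.swap_apply_of_ne_of_ne hk hkq, hkq]
  have hset : coordShadow (crosspolytope n) F j = {y | ∑ k, a k * |y k| ≤ 1} := by
    ext y
    constructor
    · rintro ⟨x, hx, rfl⟩
      rw [mem_crosspolytope hn0, Fintype.sum_eq_add_sum_subtype_ne _ j] at hx
      -- The partner's term absorbs `|x j|`, the one coordinate missing from the sum. If `q = j`
      -- there is no partner and `|x j|` is dropped.
      have hle : ∀ k : {k : Fin n // k ≠ j}, a k * |inner ℝ (F k) x| ≤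
          |x k| + if (k : Fin n) = q then |x j| else 0 := by
        rintro ⟨k, hk⟩
        by_cases hkq : k = q
        · subst hkq
          have h := abs_inner_pairVector_le (Equiv.swap j k) k x (by simpa using hk.symm)
          simpa [a, hF] using h
        · simp [a, hF, hkq, inner_pairVector, (hfix k hk).2 hkq]
      have hite : ∑ k : {k : Fin n // k ≠ j}, (if (k : Fin n) = q then |x j| else 0) ≤ |x j| := by
        by_cases hq : q = j
        · rw [Finset.sum_eq_zero fun k _ => if_neg fun h => k.2 (h.trans hq)]
          positivity
        · rw [Finset.sum_eq_single ⟨q, hq⟩] <;> simp +contextual [Subtype.ext_iff]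
      refine (Finset.sum_le_sum fun k _ => hle k).trans ?_
      rw [Finset.sum_add_distrib]
      linarith
    · intro hy
      refine sum_mem_coordShadow F j y ((mem_crosspolytope hn0 _).2 ?_)
      refine (sum_abs_sum_smul_le _ _ _).trans (le_trans (Finset.sum_le_sum fun k _ => ?_) hy)
      rw [mul_comm, hF]
      gcongr
      refine (sum_abs_pairVector_le _ _).trans_eq ?_
      simp only [a, hfix k k.2, ite_not, ne_eq]
  rw [projVol_eq_volume_coordShadow, hset, volume_real_sum_mul_abs_le_one, hcard]
  · congr 1
    by_cases hq : q = j
    · rw [if_pos hq]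
      exact Finset.prod_eq_one fun k _ => if_neg fun h => k.2 (h.trans hq)
    · rw [if_neg hq, Finset.prod_eq_single ⟨q, hq⟩] <;> simp +contextual [a, Subtype.ext_iff]
  · intro k
    simp only [a]
    split_ifs <;> positivity

/-- `pairVector σ j` depends on `σ` only through `σ j`, so `σ` may be replaced by the transposition
of `j` and `σ j`. -/
theorem projVol_crosspolytope_pairVector {n : ℕ} (hn : 2 ≤ n) (σ : Fin n → Fin n) (j : Fin n) :
    projVol (crosspolytope n) (pairVector σ j) =
      2 ^ (n - 1) / (n - 1).factorial / if σ j = j then 1 else √2 := by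
  obtain ⟨F, hF⟩ := exists_frame_eq
    (orthonormal_pairVector (σ := Equiv.swap j (σ j)) fun k => Equiv.swap_apply_self _ _ _)
  rw [← projVol_crosspolytope_of_swap hn j (σ j) F hF, hF]
  simp [pairVector]

theorem lwRatio_crosspolytope_of_pairVector {n : ℕ} (hn : 2 ≤ n) (σ : Fin n → Fin n) (F : Frame n)
    (hF : ⇑F = pairVector σ) :
    lwRatio (crosspolytope n) F =
      (n - 1).factorial * (∏ j, if σ j = j then 1 else √2) / (n : ℝ) ^ (n - 1) := by
  have hvol := volume_real_crosspolytope (n := n) (by omega)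
  have hne : (∏ j, if σ j = j then 1 else √2) ≠ 0 := by
    refine Finset.prod_ne_zero_iff.2 fun j _ => ?_
    split_ifs <;> positivity
  rw [lwRatio, projAverage, hvol, hF]
  simp_rw [projVol_crosspolytope_pairVector hn]
  rw [Finset.prod_div_distrib, Finset.prod_const, Finset.card_univ, Fintype.card_fin]
  obtain ⟨m, rfl⟩ : ∃ m, n = m + 1 := ⟨n - 1, by omega⟩
  simp only [Nat.add_sub_cancel, Nat.factorial_succ, Nat.cast_mul]
  have : (m.factorial : ℝ) ≠ 0 := by positivity
  have hm : ((m + 1 : ℕ) : ℝ) ≠ 0 := by positivity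
  generalize ((m + 1 : ℕ) : ℝ) = N at *
  rw [div_pow, div_pow, mul_pow, ← pow_mul, ← pow_mul, mul_comm (m + 1) m,
    pow_succ (m.factorial : ℝ)]
  field_simp

/-! ### Edges of the crosspolytope -/

/-- The functional `x i - s * x j` is at most `|x i| + |x j| ≤ 1` on the crosspolytope. Equality
kills the other coordinates and fixes the signs of these two. -/
theorem isExposed_segment_crosspolytope {n : ℕ} (i j : Fin n) (hij : i ≠ j) (s : ℝ)
    (hs : s = 1 ∨ s = -1) :
    IsExposed ℝ (crosspolytope n)
      (segment ℝ (-(s • EuclideanSpace.single j (1 : ℝ))) (EuclideanSpace.single i (1 : ℝ))) := by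
  have hn : 0 < n := i.pos
  have hss : s * s = 1 := by rcases hs with rfl | rfl <;> norm_num
  have habs : |s| = 1 := by rcases hs with rfl | rfl <;> norm_num
  intro _
  let l : StrongDual ℝ (EuclideanSpace ℝ (Fin n)) :=
    EuclideanSpace.proj i - s • EuclideanSpace.proj j
  have hl : ∀ x, l x = x i - s * x j := fun x => rfl
  have hsum : ∀ x : EuclideanSpace ℝ (Fin n),
      ∑ k, |x k| = |x i| + |x j| + ∑ k ∈ Finset.univ \ {i, j}, |x k| := by
    intro x
    rw [← Finset.sum_pair (f := fun k => |x k|) hij, add_comm, Finset.sum_sdiff (Finset.subset_univ _)]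
  have hle : ∀ x ∈ crosspolytope n, l x ≤ 1 := by
    intro x hx
    rw [mem_crosspolytope hn, hsum] at hx
    have h0 : 0 ≤ ∑ k ∈ Finset.univ \ {i, j}, |x k| := by positivity
    have h1 := le_abs_self (x i)
    have h2 := neg_abs_le (s * x j)
    rw [abs_mul, habs, one_mul] at h2
    rw [hl]
    linarith
  have hmem : EuclideanSpace.single i (1 : ℝ) ∈ crosspolytope n :=
    subset_convexHull _ _ ⟨i, Or.inl rfl⟩
  have hval : l (EuclideanSpace.single i (1 : ℝ)) = 1 := by simp [hl, hij]
  refine ⟨l, ?_⟩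
  ext x
  constructor
  · rintro ⟨a, b, ha, hb, hab, rfl⟩
    have hconv : Convex ℝ (crosspolytope n) := convex_convexHull _ _
    have hmem' : -(s • EuclideanSpace.single j (1 : ℝ)) ∈ crosspolytope n := by
      rcases hs with rfl | rfl
      · exact subset_convexHull _ _ ⟨j, Or.inr (by simp)⟩
      · exact subset_convexHull _ _ ⟨j, Or.inl (by simp)⟩
    refine ⟨hconv hmem' hmem ha hb hab, fun y hy => (hle y hy).trans_eq ?_⟩
    have hval' : l (-(s • EuclideanSpace.single j (1 : ℝ))) = 1 := by simp [hl, hij.symm, hss]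
    rw [map_add, map_smul, map_smul, hval, hval', smul_eq_mul, smul_eq_mul, mul_one, mul_one, hab]
  · rintro ⟨hx, hmax⟩
    have h1 : 1 ≤ x i - s * x j := by
      have := hmax _ hmem
      rwa [hval, hl] at this
    rw [mem_crosspolytope hn, hsum] at hx
    have h0 : 0 ≤ ∑ k ∈ Finset.univ \ {i, j}, |x k| := by positivity
    have h2 := le_abs_self (x i)
    have h3 := neg_abs_le (s * x j)
    have h4 := abs_nonneg (x i)
    have h5 := abs_nonneg (x j)
    rw [abs_mul, habs, one_mul] at h3
    have h6 : ∑ k ∈ Finset.univ \ {i, j}, |x k| = 0 := by linarith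
    have h7 : ∀ k, k ≠ i → k ≠ j → x k = 0 := by
      intro k hki hkj
      simpa using (Finset.sum_eq_zero_iff_of_nonneg fun k _ => abs_nonneg (x k)).1 h6 k
        (by simp [hki, hkj])
    -- Equality throughout makes these two coefficients nonnegative with sum `1`.
    refine ⟨-(s * x j), x i, by linarith, by linarith, by linarith, ?_⟩
    ext k
    by_cases hki : k = i
    · subst hki
      simp [hij]
    · by_cases hkj : k = j
      · subst hkj
        simp [hki]
        linear_combination x k * hss
      · simp [hki, hkj, h7 k hki hkj]

theorem isEdgeDirection_crosspolytope {n : ℕ} (i j : Fin n) (hij : i ≠ j) (s c : ℝ)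
    (hs : s = 1 ∨ s = -1) (hc : c ≠ 0) :
    IsEdgeDirection (crosspolytope n)
      (c • (EuclideanSpace.single i (1 : ℝ) + s • EuclideanSpace.single j (1 : ℝ))) := by
  have hne : EuclideanSpace.single i (1 : ℝ) + s • EuclideanSpace.single j (1 : ℝ) ≠ 0 := by
    intro h
    have := congrArg (fun x : EuclideanSpace ℝ (Fin n) => x i) h
    simp [hij] at this
  refine ⟨smul_ne_zero hc hne, -(s • EuclideanSpace.single j (1 : ℝ)), EuclideanSpace.single i 1,
    fun h => hne ?_, isExposed_segment_crosspolytope i j hij s hs, c, by rw [sub_neg_eq_add]⟩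
  rw [← h, neg_add_cancel]

theorem isEdgeDirection_crosspolytope_pairVector {n : ℕ} (σ : Fin n → Fin n) (k : Fin n)
    (h : σ k ≠ k) : IsEdgeDirection (crosspolytope n) (pairVector σ k) := by
  have hc : (1 / √2 : ℝ) ≠ 0 := by positivity
  unfold pairVector
  rw [if_neg h]
  split_ifs
  · simpa using isEdgeDirection_crosspolytope k (σ k) h.symm 1 _ (Or.inl rfl) hc
  · simpa [sub_eq_add_neg] using isEdgeDirection_crosspolytope (σ k) k h (-1) _ (Or.inr rfl) hc

/-! ### The frame of adjacent pairs -/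

/-- The involution that exchanges `i` and `i + 1` for even `i`, and fixes the last index if it is
left over. -/
def adjacentSwap {n : ℕ} (k : Fin n) : Fin n :=
  if Even (k : ℕ) then if h : (k : ℕ) + 1 < n then ⟨k + 1, h⟩ else k
  else ⟨k - 1, (Nat.sub_le _ _).trans_lt k.2⟩

theorem adjacentSwap_val {n : ℕ} (k : Fin n) : (adjacentSwap k : ℕ) =
    if Even (k : ℕ) then if (k : ℕ) + 1 < n then (k : ℕ) + 1 else k else k - 1 := by
  unfold adjacentSwap
  split_ifs <;> rfl

theorem adjacentSwap_involutive (n : ℕ) : Function.Involutive (adjacentSwap (n := n)) := by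
  intro k
  ext
  have := k.2
  simp only [adjacentSwap_val, Nat.even_iff]
  split_ifs <;> omega

theorem adjacentSwap_eq_self_iff {n : ℕ} (k : Fin n) :
    adjacentSwap k = k ↔ Odd n ∧ (k : ℕ) + 1 = n := by
  have := k.2
  simp only [Fin.ext_iff, adjacentSwap_val, Nat.even_iff, Nat.odd_iff]
  split_ifs <;> omega

theorem isPairedFrame_of_pairVector {n : ℕ} (F : Frame n) (hF : ⇑F = pairVector adjacentSwap) :
    IsPairedFrame F := by
  rw [IsPairedFrame, hF]
  constructor
  · intro i j hi hj
    have hij : adjacentSwap i = j := by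
      ext
      rw [adjacentSwap_val, if_pos hi, if_pos (hj ▸ j.2), hj]
    have hji : adjacentSwap j = i := by rw [← hij, adjacentSwap_involutive]
    have hlt : i < j := Fin.lt_def.2 (by omega)
    exact ⟨by rw [pairVector, hij, if_neg hlt.ne', if_pos hlt],
      by rw [pairVector, hji, if_neg hlt.ne, if_neg hlt.asymm]⟩
  · intro i hi hin
    have : Odd n := hin ▸ hi.add_one
    rw [pairVector, if_pos ((adjacentSwap_eq_self_iff i).2 ⟨this, hin⟩)]

theorem prod_adjacentSwap_of_even {n : ℕ} (h : Even n) :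
    (∏ j : Fin n, if adjacentSwap j = j then 1 else √2) = 2 ^ (n / 2) := by
  have hno : ¬ Odd n := Nat.not_odd_iff_even.2 h
  simp only [adjacentSwap_eq_self_iff, hno, false_and, if_false, Finset.prod_const,
    Finset.card_univ, Fintype.card_fin]
  obtain ⟨m, rfl⟩ := h
  rw [show (m + m) / 2 = m by omega, ← two_mul, pow_mul, Real.sq_sqrt zero_le_two]

theorem prod_adjacentSwap_of_odd {n : ℕ} (h : Odd n) :
    (∏ j : Fin n, if adjacentSwap j = j then 1 else √2) = 2 ^ ((n - 1) / 2) := by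
  simp only [adjacentSwap_eq_self_iff, h, true_and]
  obtain ⟨m, rfl⟩ := h
  rw [Fin.prod_univ_castSucc]
  simp [Fin.val_castSucc, (Fin.is_lt _).ne, pow_mul]

theorem mainTheorem8 (n : ℕ) (hn : 2 ≤ n) :
    -- the maximum that defines the LW-constant of the crosspolytope is attained
    IsGreatest (Set.range (lwRatio (crosspolytope n))) (lwConstant (crosspolytope n)) ∧
    -- the lower bounds
    (Even n →
      lwConstant (crosspolytope n) ≥
        ((n - 1).factorial : ℝ) * 2 ^ (n / 2) / (n : ℝ) ^ (n - 1)) ∧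
    (Odd n →
      lwConstant (crosspolytope n) ≥
        ((n - 1).factorial : ℝ) * 2 ^ ((n - 1) / 2) / (n : ℝ) ^ (n - 1)) ∧
    -- they are the LW-ratios for an explicit frame of edge directions
    -- (and one coordinate direction if `n` is odd)
    (∃ F : Frame n, IsPairedFrame F ∧
      (Even n →
        (∀ i, IsEdgeDirection (crosspolytope n) (F i)) ∧
        lwRatio (crosspolytope n) F =
          ((n - 1).factorial : ℝ) * 2 ^ (n / 2) / (n : ℝ) ^ (n - 1)) ∧
      (Odd n →
        (∀ i : Fin n, (i : ℕ) + 1 < n → IsEdgeDirection (crosspolytope n) (F i)) ∧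
        lwRatio (crosspolytope n) F =
          ((n - 1).factorial : ℝ) * 2 ^ ((n - 1) / 2) / (n : ℝ) ^ (n - 1))) := by
  have hmax := isGreatest_lwConstant_crosspolytope hn
  obtain ⟨F, hF⟩ := exists_frame_eq (orthonormal_pairVector (adjacentSwap_involutive n))
  have hratio := lwRatio_crosspolytope_of_pairVector hn adjacentSwap F hF
  have heven : Even n → lwRatio (crosspolytope n) F =
      ((n - 1).factorial : ℝ) * 2 ^ (n / 2) / (n : ℝ) ^ (n - 1) := fun h => by
    rw [hratio, prod_adjacentSwap_of_even h]
  have hodd : Odd n → lwRatio (crosspolytope n) F =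
      ((n - 1).factorial : ℝ) * 2 ^ ((n - 1) / 2) / (n : ℝ) ^ (n - 1) := fun h => by
    rw [hratio, prod_adjacentSwap_of_odd h]
  have hle : lwRatio (crosspolytope n) F ≤ lwConstant (crosspolytope n) := hmax.2 ⟨F, rfl⟩
  refine ⟨hmax, fun h => (heven h).symm.trans_le hle, fun h => (hodd h).symm.trans_le hle,
    F, isPairedFrame_of_pairVector F hF, fun h => ⟨fun i => ?_, heven h⟩,
    fun h => ⟨fun i hi => ?_, hodd h⟩⟩
  · rw [hF]
    refine isEdgeDirection_crosspolytope_pairVector _ i fun hfix => ?_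
    exact Nat.not_odd_iff_even.2 h ((adjacentSwap_eq_self_iff i).1 hfix).1
  · rw [hF]
    refine isEdgeDirection_crosspolytope_pairVector _ i fun hfix => ?_
    exact hi.ne ((adjacentSwap_eq_self_iff i).1 hfix).2
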